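/- Let $P$ be the Pascal graph: its vertices are the pairs $(x,y)$ of nonnegative integers, with edges from $(x,y)$ to $(x+1,y)$ and to $(x,y+1)$; the level of $(x,y)$ is $x+y$. An ordering of $P$ is a function $\xi$ from the vertices to $\{0,1\}$: for $x,y\ge 1$, the edge from $(x-1,y)$ to $(x,y)$ is less than the edge from $(x,y-1)$ to $(x,y)$ if $\xi(x,y)=1$, and greater if $\xi(x,y)=0$. An edge is minimal (maximal) if no edge with the same range is less (greater) than it; in particular an edge entering a boundary vertex $(x,0)$ or $(0,y)$ is both. Let $X$ be the set of infinite directed paths that begin at $(0,0)$. For $\gamma,\eta\in X$ put $\gamma<\eta$ if they differ, coincide from some edge on, and at the last edge where they differ the edge of $\gamma$ is less than that of $\eta$. For $\gamma$ not consisting entirely of maximal edges, $T_\xi\gamma$ is the smallest path larger than $\gamma$. Let $X'_\xi$ be the set of all paths $T_\xi^n\gamma$ ($n\in\mathbb Z$, whenever defined), where $\gamma$ consists entirely of minimal edges or entirely of maximal edges. Let $\mathscr P_3$ be the set of the $8$ initial paths of length $3$ (those that start at $(0,0)$). For $\gamma\in X\setminus X'_\xi$ the $3$-coding $\omega_3(\gamma)\in\mathscr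 P_3^{\mathbb Z}$ is the sequence whose $n$-th entry is the initial path of length $3$ of $T_\xi^n\gamma$. The basic blocks $B(x,y)$, $x+y\ge 3$, are the following words over $\mathscr P_3$. If $x+y=3$, then $B(x,y)$ lists the initial paths of length $3$ that end at $(x,y)$ in increasing order. If $x+y>3$ and $x,y\ge 1$, then $B(x,y)=B(x,y-1)B(x-1,y)$ if $\xi(x,y)=0$, and $B(x,y)=B(x-1,y)B(x,y-1)$ if $\xi(x,y)=1$; moreover $B(x,0)=B(x-1,0)$ and $B(0,y)=B(0,y-1)$ for $x,y>3$. A $\xi$-consistent factoring scheme for a sequence $\omega\in\mathscr P_3^{\mathbb Z}$ consists, for each $n\ge 3$, of a factorization $\omega=\dots W_{n,-1}W_{n,0}W_{n,1}\dots$ such that each $W_{n,i}$ is a basic block $B(x_{n,i},y_{n,i})$ of level $x_{n,i}+y_{n,i}=n$ and such that, for each $n\geq 4$ and each $i$, there is an index $j=j(n,i)$ with the following property. Write $(x,y)=(x_{n,i},y_{n,i})$. - If $x,y\ge1$, then $W_{n,i}$ is the concatenation of the adjacent blocks $W_{n-1,j}$ and $W_{n-1,j+1}$ in their places in $\omega$,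 $j(n,i+1)=j+2$, and these two blocks are $B(x,y-1)$ and $B(x-1,y)$ in this order if $\xi(x,y)=0$, and $B(x-1,y)$ and $B(x,y-1)$ in this order if $\xi(x,y)=1$. - If $x=0$ or $y=0$, then $W_{n,i}$ is the single block $W_{n-1,j}$, $j(n,i+1)=j+1$, and this block is $B(0,y-1)$ if $x=0$ and $B(x-1,0)$ if $y=0$. Factorizations that differ only in the indexing of the blocks are identified. Then for every ordering $\xi$ of $P$ and every path $\gamma\in X\setminus X'_\xi$, the $3$-coding $\omega_3(\gamma)$ is well defined and has exactly one $\xi$-consistent factoring scheme. -/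

import Mathlib

namespace PascalAdic

/-! ### The Pascal graph, its orderings and its infinite paths -/

/-- Vertices of the Pascal graph; the level of `(x, y)` is `x + y`. -/
abbrev Vertex : Type := ℕ × ℕ

/-- There is an edge from `u` to `v`. (There is at most one edge between two vertices, so an
edge is given by its source and its range, and a path by the vertices it visits.) -/
def Edge (u v : Vertex) : Prop :=
  v = (u.1 + 1, u.2) ∨ v = (u.1, u.2 + 1)

/-- An ordering of the Pascal graph. -/
abbrev EdgeOrdering : Type := Vertex → Fin 2

/-- The edge from `u` to `v` is less than the edge from `u'` to `v`. Two different edges enter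
`v = (x, y)` only if `x, y ≥ 1`; then the edge from `(x - 1, y)` is less than the edge from
`(x, y - 1)` if and only if `ξ (x, y) = 1`. -/
def EdgeLT (ξ : EdgeOrdering) (u u' v : Vertex) : Prop :=
  ∃ x y : ℕ, v = (x + 1, y + 1) ∧
    ((ξ v = 1 ∧ u = (x, y + 1) ∧ u' = (x + 1, y)) ∨
     (ξ v = 0 ∧ u = (x + 1, y) ∧ u' = (x, y + 1)))

/-- The space `X` of infinite directed paths that begin at the root. The `n`-th edge
(`n = 0, 1, 2, …`) of such a path goes from `vert n` to `vert (n + 1)`. -/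
structure Path : Type where
  vert : ℕ → Vertex
  vert_zero : vert 0 = (0, 0)
  edge : ∀ n, Edge (vert n) (vert (n + 1))

/-- The order of `X` determined by `ξ`: the paths `γ` and `η` coincide after the `n`-th edge,
and the `n`-th edge of `γ` is less than the `n`-th edge of `η`. -/
def PathLT (ξ : EdgeOrdering) (γ η : Path) : Prop :=
  ∃ n, (∀ m, n < m → γ.vert m = η.vert m) ∧
    EdgeLT ξ (γ.vert n) (η.vert n) (γ.vert (n + 1))

/-- The paths that consist entirely of maximal edges. -/
def maxPaths (ξ : EdgeOrdering) : Set Path :=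
  {γ | ∀ n, ¬ ∃ u, EdgeLT ξ (γ.vert n) u (γ.vert (n + 1))}

/-- The paths that consist entirely of minimal edges. -/
def minPaths (ξ : EdgeOrdering) : Set Path :=
  {γ | ∀ n, ¬ ∃ u, EdgeLT ξ u (γ.vert n) (γ.vert (n + 1))}

/-! ### The adic transformation and the coding of orbits -/

/-- The graph of the adic transformation `T`: `γ` is not a maximal path, and `η = T γ` is the
smallest path larger than `γ`. -/
def AdicStep (ξ : EdgeOrdering) (γ η : Path) : Prop :=
  γ ∉ maxPaths ξ ∧ PathLT ξ γ η ∧ ∀ δ, PathLT ξ γ δ → η = δ ∨ PathLT ξ η δ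

/-- `T ^ n γ` is defined and equal to `η`, for a natural number `n`. -/
def AdicIterNat (ξ : EdgeOrdering) : ℕ → Path → Path → Prop
  | 0, γ, η => γ = η
  | n + 1, γ, η => ∃ δ, AdicIterNat ξ n γ δ ∧ AdicStep ξ δ η

/-- `T ^ n γ` is defined and equal to `η`, for an integer `n`. -/
def AdicIter (ξ : EdgeOrdering) : ℤ → Path → Path → Prop
  | Int.ofNat n, γ, η => AdicIterNat ξ n γ η
  | Int.negSucc n, γ, η => AdicIterNat ξ (n + 1) η γ

/-- The set `X'` of the paths in the orbit of a minimal or a maximal path. -/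
def exceptionalPaths (ξ : EdgeOrdering) : Set Path :=
  {η | ∃ γ ∈ minPaths ξ ∪ maxPaths ξ, ∃ n : ℤ, AdicIter ξ n γ η}

/-- The initial paths of length `k`, which are the symbols of the alphabet `𝒫_k`. -/
structure Symbol (k : ℕ) : Type where
  vert : Fin (k + 1) → Vertex
  vert_zero : vert 0 = (0, 0)
  edge : ∀ i : Fin k, Edge (vert i.castSucc) (vert i.succ)

/-- The cylinder set in `X` of an initial path. -/
def cylinder {k : ℕ} (p : Symbol k) : Set Path :=
  {γ | ∀ i : Fin (k + 1), γ.vert i = p.vert i}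

/-- `ω` is the (two-sided) `k`-coding of `γ`: for every integer `n`, `T ^ n γ` is defined and
lies in the cylinder set `ω n`. -/
def IsCoding (ξ : EdgeOrdering) (k : ℕ) (γ : Path) (ω : ℤ → Symbol k) : Prop :=
  ∀ n : ℤ, ∃ η, AdicIter ξ n γ η ∧ η ∈ cylinder (ω n)

/-! ### Basic blocks -/

/-- The order on initial paths with a common end vertex. -/
def SymbolLT (ξ : EdgeOrdering) {k : ℕ} (p q : Symbol k) : Prop :=
  ∃ n : Fin k, (∀ i : Fin (k + 1), n.castSucc < i → p.vert i = q.vert i) ∧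
    EdgeLT ξ (p.vert n.castSucc) (q.vert n.castSucc) (p.vert n.succ)

/-- `IsBasicBlock ξ k v l`: the vertex `v` has level at least `k`, and `l` is the basic block
`B^k(v)` of the `k`-coding. At a vertex of level `k` it is the increasing enumeration of the
initial paths that end there; at later vertices the basic blocks at the sources of the incoming
edges are concatenated in the order of these edges. -/
inductive IsBasicBlock (ξ : EdgeOrdering) (k : ℕ) : Vertex → List (Symbol k) → Prop
  | base {v : Vertex} {l : List (Symbol k)} (hv : v.1 + v.2 = k)
      (increasing : l.Pairwise (SymbolLT ξ))
      (mem_iff : ∀ p : Symbol k, p ∈ l ↔ p.vert (Fin.last k) = v) : IsBasicBlock ξ k v l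
  | left {x : ℕ} {l : List (Symbol k)} (h : IsBasicBlock ξ k (x, 0) l) :
      IsBasicBlock ξ k (x + 1, 0) l
  | right {y : ℕ} {l : List (Symbol k)} (h : IsBasicBlock ξ k (0, y) l) :
      IsBasicBlock ξ k (0, y + 1) l
  | interior_zero {x y : ℕ} {l₁ l₂ : List (Symbol k)} (hξ : ξ (x + 1, y + 1) = 0)
      (h₁ : IsBasicBlock ξ k (x + 1, y) l₁) (h₂ : IsBasicBlock ξ k (x, y + 1) l₂) :
      IsBasicBlock ξ k (x + 1, y + 1) (l₁ ++ l₂)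
  | interior_one {x y : ℕ} {l₁ l₂ : List (Symbol k)} (hξ : ξ (x + 1, y + 1) = 1)
      (h₁ : IsBasicBlock ξ k (x, y + 1) l₁) (h₂ : IsBasicBlock ξ k (x + 1, y) l₂) :
      IsBasicBlock ξ k (x + 1, y + 1) (l₁ ++ l₂)

/-! ### Consistent factoring schemes -/

/-- The finite word `ω_a ω_{a+1} … ω_{b-1}`. -/
def word {A : Type*} (ω : ℤ → A) (a b : ℤ) : List A :=
  List.ofFn fun t : Fin (b - a).toNat => ω (a + (t : ℕ))

/-- The data of a factoring scheme for a sequence `ω` over `𝒫_k`. For each level `n = k + m`,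
the sequence is cut into blocks `W_{n,i}`, `i ∈ ℤ`, where `W_{n,i}` occupies the coordinates
from `cut m i` to `cut m (i + 1) - 1` and is the basic block at the vertex `vert m i`. The
number `sub m i` is the index `j(n + 1, i)` of the first level `n` block in `W_{n+1,i}`. -/
structure FactoringScheme : Type where
  cut : ℕ → ℤ → ℤ
  vert : ℕ → ℤ → Vertex
  sub : ℕ → ℤ → ℤ

/-- `F` is a `ξ`-consistent factoring scheme for `ω`. The blocks of each level are indexed so
that the one with index `0` contains the coordinate `0` of `ω`; this excludes different
indexings of one and the same factorization. A block at an interior vertex is the concatenation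
of two adjacent blocks of the preceding level, in the order given by `ξ`; a block at a boundary
vertex `(x, 0)` or `(0, y)`, which only one edge enters, is a single block of the
preceding level. -/
structure IsConsistent (ξ : EdgeOrdering) (k : ℕ) (ω : ℤ → Symbol k) (F : FactoringScheme) :
    Prop where
  strictMono : ∀ m, StrictMono (F.cut m)
  central : ∀ m, F.cut m 0 ≤ 0 ∧ 0 < F.cut m 1
  level : ∀ m i, (F.vert m i).1 + (F.vert m i).2 = k + m
  block : ∀ m i, IsBasicBlock ξ k (F.vert m i) (word ω (F.cut m i) (F.cut m (i + 1)))
  cut_succ : ∀ m i, F.cut (m + 1) i = F.cut m (F.sub m i)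
  left : ∀ m i x, F.vert (m + 1) i = (x + 1, 0) →
    F.sub m (i + 1) = F.sub m i + 1 ∧ F.vert m (F.sub m i) = (x, 0)
  right : ∀ m i y, F.vert (m + 1) i = (0, y + 1) →
    F.sub m (i + 1) = F.sub m i + 1 ∧ F.vert m (F.sub m i) = (0, y)
  interior : ∀ m i x y, F.vert (m + 1) i = (x + 1, y + 1) →
    F.sub m (i + 1) = F.sub m i + 2 ∧
    (ξ (x + 1, y + 1) = 0 →
      F.vert m (F.sub m i) = (x + 1, y) ∧ F.vert m (F.sub m i + 1) = (x, y + 1)) ∧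
    (ξ (x + 1, y + 1) = 1 →
      F.vert m (F.sub m i) = (x, y + 1) ∧ F.vert m (F.sub m i + 1) = (x + 1, y))

end PascalAdic

namespace PascalAdic

/-! ### Enumerations of subsets of the integers -/

/-! Existence comes from counting. The `rank` of a path at level `n` is the position of its initial
segment among all segments with the same end vertex `v`; it takes each value below `height v`
exactly once. Among paths with the same tail, `ξ` orders by rank, so one adic step raises the rank
by one until the last value is reached and then resets it to zero. Off the exceptional set the orbit
is two-sided, and cutting it at the times of rank zero gives the level-`n` blocks (`exists_cut`,
`isBasicBlock_word`, `exists_isConsistent`).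

Uniqueness is an induction on the level (`IsConsistent.cut_vert_eq`). At the lowest level the
symbols themselves show the cuts. In the step, the blocks of level `n` with their vertices are
known, and it has to be seen which adjacent ones are joined at level `n + 1`. Two ways of joining
are compared as two `IsPairing` structures on the same vertex sequence. If pairs of the two overlap
in one block, the ordering forces three consecutive vertices to move steadily in one direction. For
`n ≥ 3` this monotone run extends far enough on one side that some newly formed block fits neither
of its neighbours at level `n + 2` (`IsPairing.not_overlap_up`). So pairs never overlap; a pair of
one pairing that is missing from the other would then consist of two boundary vertices, which are
not adjacent when `n ≥ 3`. -/

theorem exists_le_lt_of_strictMono {f : ℤ → ℤ} (hf : StrictMono f) (p : ℤ) :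
    ∃ i, f i ≤ p ∧ p < f (i + 1) := by
  have up : ∀ k : ℕ, f 0 + k ≤ f k := by
    intro k
    induction k with
    | zero => simp
    | succ k ih => have := hf (show (k : ℤ) < k + 1 by omega); push_cast; omega
  have down : ∀ k : ℕ, f (-k) ≤ f 0 - k := by
    intro k
    induction k with
    | zero => simp
    | succ k ih =>
      have := hf (show (-(k + 1 : ℕ) : ℤ) < -k by push_cast; omega)
      push_cast at this ⊢; omega
  obtain ⟨i, hi, hmax⟩ := Int.exists_greatest_of_bdd (P := fun i => f i ≤ p)
    ⟨(p - f 0).toNat + 1, fun z hz => by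
      by_contra hlt
      have h1 := up ((p - f 0).toNat + 1)
      have h2 := hf.monotone (show (((p - f 0).toNat + 1 : ℕ) : ℤ) ≤ z by push_cast; omega)
      push_cast at h1 h2
      omega⟩
    ⟨-((f 0 - p).toNat : ℤ), by
      have := down (f 0 - p).toNat
      omega⟩
  refine ⟨i, hi, ?_⟩
  by_contra h
  have := hmax (i + 1) (by omega)
  omega

/-- A set enumerated increasingly by the integers determines the enumeration up to a shift, and the
shift is fixed by the point `z` lying between the values at `0` and `1`. -/
theorem strictMono_int_ext {f g : ℤ → ℤ} (hf : StrictMono f) (hg : StrictMono g)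
    (hr : Set.range f = Set.range g) {z : ℤ} (hf0 : f 0 ≤ z ∧ z < f 1) (hg0 : g 0 ≤ z ∧ z < g 1) :
    f = g := by
  have key : ∀ {f g : ℤ → ℤ}, StrictMono f → StrictMono g → Set.range f = Set.range g →
      ∀ i j : ℤ, f i = g j → f (i + 1) ≤ g (j + 1) ∧ g (j - 1) ≤ f (i - 1) := by
    intro f g hf hg hr i j h
    constructor
    · obtain ⟨a, ha⟩ : g (j + 1) ∈ Set.range f := hr ▸ ⟨_, rfl⟩
      have h1 : f i < f a := by rw [ha, h]; exact hg (by omega)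
      have h2 := hf.lt_iff_lt.1 h1
      rw [← ha]; exact hf.monotone (by omega)
    · obtain ⟨a, ha⟩ : g (j - 1) ∈ Set.range f := hr ▸ ⟨_, rfl⟩
      have h1 : f a < f i := by rw [ha, h]; exact hg (by omega)
      have h2 := hf.lt_iff_lt.1 h1
      rw [← ha]; exact hf.monotone (by omega)
  have zero : ∀ {f g : ℤ → ℤ}, StrictMono f → StrictMono g → Set.range f = Set.range g →
      f 0 ≤ z ∧ z < f 1 → g 0 ≤ z ∧ z < g 1 → f 0 ≤ g 0 := by
    intro f g hf hg hr hf0 hg0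
    obtain ⟨a, ha⟩ : f 0 ∈ Set.range g := hr ▸ ⟨_, rfl⟩
    have h2 := hg.lt_iff_lt.1 (show g a < g 1 by omega)
    rw [← ha]; exact hg.monotone (by omega)
  have h0 := le_antisymm (zero hf hg hr hf0 hg0) (zero hg hf hr.symm hg0 hf0)
  funext i
  induction i using Int.induction_on with
  | zero => exact h0
  | succ i ih => exact le_antisymm (key hf hg hr _ _ ih).1 (key hg hf hr.symm _ _ ih.symm).1
  | pred i ih => exact le_antisymm (key hg hf hr.symm _ _ ih.symm).2 (key hf hg hr _ _ ih).2

theorem exists_enumeration {S : Set ℤ} (hlow : ∀ z, ∃ s ∈ S, s ≤ z) (hup : ∀ z, ∃ s ∈ S, z < s) :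
    ∃ f : ℤ → ℤ, StrictMono f ∧ Set.range f = S ∧ f 0 ≤ 0 ∧ 0 < f 1 := by
  have next : ∀ z, ∃ s ∈ S, z < s ∧ ∀ t ∈ S, z < t → s ≤ t := by
    intro z
    obtain ⟨s, hs, hmin⟩ := Int.exists_least_of_bdd (P := fun s => s ∈ S ∧ z < s)
      ⟨z, fun t ht => ht.2.le⟩ (by simpa using hup z)
    exact ⟨s, hs.1, hs.2, fun t ht h => hmin t ⟨ht, h⟩⟩
  have prev : ∀ z, ∃ s ∈ S, s ≤ z ∧ ∀ t ∈ S, t ≤ z → t ≤ s := by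
    intro z
    obtain ⟨s, hs, hmax⟩ := Int.exists_greatest_of_bdd (P := fun s => s ∈ S ∧ s ≤ z)
      ⟨z, fun t ht => ht.2⟩ (by simpa using hlow z)
    exact ⟨s, hs.1, hs.2, fun t ht h => hmax t ⟨ht, h⟩⟩
  choose nx nxS nxlt nxmin using next
  choose pv pvS pvle pvmax using prev
  let u : ℕ → ℤ := fun k => Nat.rec (pv 0) (fun _ a => nx a) k
  -- `pv` allows equality, so the strict predecessor of `a` is `pv (a - 1)`.
  let d : ℕ → ℤ := fun k => Nat.rec (pv 0) (fun _ a => pv (a - 1)) k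
  let f : ℤ → ℤ := fun i => if 0 ≤ i then u i.toNat else d (-i).toNat
  have uS : ∀ k, u k ∈ S := fun k => by cases k <;> simp [u, nxS, pvS]
  have dS : ∀ k, d k ∈ S := fun k => by cases k <;> simp [d, pvS]
  have fS : ∀ i, f i ∈ S := fun i => by by_cases h : 0 ≤ i <;> simp [f, h, uS, dS]
  have step : ∀ i, f i < f (i + 1) ∧ ∀ t ∈ S, f i < t → f (i + 1) ≤ t := by
    intro i
    by_cases h : 0 ≤ i
    · have h1 : f (i + 1) = nx (f i) := by
        have : (i + 1).toNat = i.toNat + 1 := by omega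
        simp [f, h, this, u, show 0 ≤ i + 1 by omega]
      rw [h1]; exact ⟨nxlt _, nxmin _⟩
    · have h1 : f i = pv (f (i + 1) - 1) := by
        have e : f (i + 1) = d (-(i + 1)).toNat := by
          by_cases h' : 0 ≤ i + 1
          · obtain rfl : i = -1 := by omega
            simp [f, u, d]
          · simp only [f, if_neg h']
        have : (-i).toNat = (-(i + 1)).toNat + 1 := by omega
        rw [e]
        simp only [f, if_neg h, this]
        simp [d]
      have h2 := pvle (f (i + 1) - 1)
      refine ⟨by omega, fun t ht hlt => ?_⟩
      by_contra hcon
      have := pvmax (f (i + 1) - 1) t ht (by omega)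
      omega
  have hf : StrictMono f := strictMono_int_of_lt_succ fun i => (step i).1
  refine ⟨f, hf, ?_, ?_, ?_⟩
  · ext t
    refine ⟨by rintro ⟨i, rfl⟩; exact fS i, fun ht => ?_⟩
    obtain ⟨i, hi, hlt⟩ := exists_le_lt_of_strictMono hf t
    rcases hi.eq_or_lt with h | h
    · exact ⟨i, h⟩
    · have := (step i).2 t ht h
      omega
  · have : f 0 = pv 0 := by simp [f, u]
    rw [this]; exact pvle 0
  · by_contra h
    have h1 := pvmax 0 (f 1) (fS 1) (by omega)
    have h2 := (step 0).1
    have : f 0 = pv 0 := by simp [f, u]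
    simp only [zero_add] at h2
    omega

/-! ### Pairings -/

/-- The combinatorics of grouping the vertices at level `n` of a factoring scheme into blocks of
level `n + 1`: `y` is the second coordinate of the vertices of level `n`, `P p` says that `p` and
`p + 1` belong to the same block of level `n + 1`, `L p` is the second coordinate of the vertex of
the block of level `n + 1` to which `p` belongs, and `up` is the ordering at level `n + 1`. -/
structure IsPairing (n : ℤ) (up : ℤ → Prop) (y : ℤ → ℤ) (P : ℤ → Prop) (L : ℤ → ℤ) : Prop where
  not_succ : ∀ p, P p → ¬ P (p + 1)
  pair : ∀ p, P p → (y (p + 1) = y p + 1 ∧ up (y (p + 1)) ∧ L p = y (p + 1)) ∨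
    (y (p + 1) = y p - 1 ∧ ¬ up (y p) ∧ L p = y p)
  label_succ : ∀ p, P p → L (p + 1) = L p
  single : ∀ p, ¬ P p → ¬ P (p - 1) → (y p = 0 ∧ L p = 0) ∨ (y p = n ∧ L p = n + 1)
  -- This condition looks two levels up: a pair forms a block at an interior vertex, which at level
  -- `n + 2` must be joined to the block on its right or left, and joined blocks have labels
  -- differing by one.
  neighbour : ∀ p, P p → L (p + 2) = L p + 1 ∨ L (p + 2) = L p - 1 ∨
    L (p - 1) = L p + 1 ∨ L (p - 1) = L p - 1

/-- Exchanging the two coordinates turns falling pairs into rising ones, so only one direction needs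
an argument. -/
theorem IsPairing.reflect {n : ℤ} {up : ℤ → Prop} {y : ℤ → ℤ} {P : ℤ → Prop} {L : ℤ → ℤ}
    (h : IsPairing n up y P L) :
    IsPairing n (fun l => ¬ up (n + 1 - l)) (fun p => n - y p) P (fun p => n + 1 - L p) where
  not_succ := h.not_succ
  pair p hp := by
    rcases h.pair p hp with ⟨h1, h2, h3⟩ | ⟨h1, h2, h3⟩
    · refine Or.inr ⟨by omega, ?_, by omega⟩
      rw [not_not, show n + 1 - (n - y p) = y (p + 1) by omega]; exact h2
    · refine Or.inl ⟨by omega, ?_, by omega⟩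
      rw [show n + 1 - (n - y (p + 1)) = y p by omega]; exact h2
  label_succ p hp := by have := h.label_succ p hp; omega
  single p h1 h2 := by have := h.single p h1 h2; omega
  neighbour p hp := by have := h.neighbour p hp; omega

section
variable {n : ℤ} {up : ℤ → Prop} {y : ℤ → ℤ} {P Q : ℤ → Prop} {L M : ℤ → ℤ}

theorem IsPairing.not_overlap_up (hn : 3 ≤ n) (hy : ∀ p, 0 ≤ y p ∧ y p ≤ n)
    (hP : IsPairing n up y P L) (hQ : IsPairing n up y Q M) {p : ℤ}
    (hp : P (p + 1)) (hq : Q p) (hup : y (p + 2) = y (p + 1) + 1) : False := by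
  have transfer : ∀ {a b : ℤ}, up a → ¬ up b → a ≠ b := fun ha hb h => hb (h ▸ ha)
  have hyp := hy p
  have hyp1 := hy (p + 1)
  have hyp2 := hy (p + 2)
  have hP1 := hP.pair _ hp
  rw [show p + 1 + 1 = p + 2 by ring] at hP1
  obtain ⟨-, up2, hL1⟩ : _ ∧ up (y (p + 2)) ∧ L (p + 1) = y (p + 2) := by
    rcases hP1 with h | h
    · exact h
    · omega
  -- A falling `Q`-pair would have the label `y (p + 2)`, where the ordering is already known to be
  -- rising.
  obtain ⟨hy0, up1, hM0⟩ : y (p + 1) = y p + 1 ∧ up (y (p + 1)) ∧ M p = y (p + 1) := by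
    rcases hQ.pair _ hq with h | ⟨h1, h2, h3⟩
    · exact h
    · exact absurd (by omega) (transfer up2 h2)
  have hP0 : ¬ P p := fun h => hP.not_succ _ h hp
  have hP2 : ¬ P (p + 2) := by
    have := hP.not_succ _ hp
    rwa [show p + 1 + 1 = p + 2 by ring] at this
  have hQ1 : ¬ Q (p + 1) := hQ.not_succ _ hq
  have hQm : ¬ Q (p - 1) := fun h => by
    have := hQ.not_succ _ h
    rw [sub_add_cancel] at this
    exact this hq
  -- In `P` the block `p` can only close a pair or stand alone. Away from the boundary it closes a
  -- rising pair, which continues the run to the left; dually, `Q` continues it to the right of `p +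
  -- 2`.
  have hL0 : L p = y p ∧ (0 < y p → y (p - 1) = y p - 1 ∧ up (y p)) := by
    by_cases h : P (p - 1)
    · have e := hP.label_succ _ h
      have h' := hP.pair _ h
      rw [sub_add_cancel] at e h'
      rcases h' with ⟨h1, h2, h3⟩ | ⟨h1, h2, h3⟩
      · exact ⟨by omega, fun _ => ⟨by omega, h2⟩⟩
      · exact absurd (by omega) (transfer up1 h2)
    · have := hP.single p hP0 h
      exact ⟨by omega, fun _ => by omega⟩
  have hM2 : M (p + 2) = y (p + 2) + 1 ∧
      (y (p + 2) < n → y (p + 3) = y (p + 2) + 1 ∧ up (y (p + 3))) := by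
    by_cases h : Q (p + 2)
    · have h' := hQ.pair _ h
      rw [show p + 2 + 1 = p + 3 by ring] at h'
      rcases h' with ⟨h1, h2, h3⟩ | ⟨h1, h2, h3⟩
      · exact ⟨by omega, fun _ => ⟨by omega, h2⟩⟩
      · exact absurd rfl (transfer up2 h2)
    · have := hQ.single (p + 2) h (by rwa [show p + 2 - 1 = p + 1 by ring])
      exact ⟨by omega, fun _ => by omega⟩
  -- If `y (p + 2) < n`, both neighbours of the `P`-block on `p + 1, p + 2` have labels at distance
  -- two. If `y (p + 2) = n`, then `y p = n - 2 > 0`, the run extends to the left, and the same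
  -- happens to the `Q`-block on `p, p + 1`. Here `n ≥ 3` is essential.
  rcases hyp2.2.lt_or_eq with hlt | heq
  · obtain ⟨hy3, up3⟩ := hM2.2 hlt
    have hN := hP.neighbour _ hp
    rw [show p + 1 + 2 = p + 3 by ring, show p + 1 - 1 = p by ring] at hN
    by_cases h : P (p + 3)
    · rcases hP.pair _ h with ⟨h1, h2, h3⟩ | ⟨h1, h2, h3⟩
      · omega
      · exact transfer up3 h2 rfl
    · have := hP.single (p + 3) h (by rwa [show p + 3 - 1 = p + 2 by ring])
      omega
  · obtain ⟨hym, up0⟩ := hL0.2 (by omega)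
    have hN := hQ.neighbour _ hq
    by_cases h : Q (p - 2)
    · have e := hQ.label_succ _ h
      have h' := hQ.pair _ h
      rw [show p - 2 + 1 = p - 1 by ring] at e h'
      rcases h' with ⟨h1, h2, h3⟩ | ⟨h1, h2, h3⟩
      · omega
      · exact transfer up0 h2 (by omega)
    · have := hQ.single (p - 1) hQm (by rwa [show p - 1 - 1 = p - 2 by ring])
      omega

theorem IsPairing.not_overlap (hn : 3 ≤ n) (hy : ∀ p, 0 ≤ y p ∧ y p ≤ n)
    (hP : IsPairing n up y P L) (hQ : IsPairing n up y Q M) {p : ℤ}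
    (hp : P (p + 1)) (hq : Q p) : False := by
  rcases hP.pair _ hp with ⟨h, -⟩ | ⟨h, -⟩ <;> rw [show p + 1 + 1 = p + 2 by ring] at h
  · exact hP.not_overlap_up hn hy hQ hp hq h
  · exact hP.reflect.not_overlap_up hn (fun p => by have := hy p; omega) hQ.reflect hp hq
      (by omega)

/-- Without overlaps, a pair absent from `Q` has both members single in `Q`, so both values of `y`
lie in `{0, n}`; but they differ by one. -/
theorem IsPairing.le (hn : 3 ≤ n) (hy : ∀ p, 0 ≤ y p ∧ y p ≤ n)
    (hP : IsPairing n up y P L) (hQ : IsPairing n up y Q M) {p : ℤ} (hp : P p) : Q p := by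
  by_contra hq
  have h1 : ¬ Q (p - 1) := fun h =>
    hP.not_overlap hn hy hQ (p := p - 1) (by simpa using hp) h
  have h2 : ¬ Q (p + 1) := fun h => hQ.not_overlap hn hy hP h hp
  have h3 := hQ.single p hq h1
  have h4 := hQ.single (p + 1) h2 (by simpa using hq)
  have h5 := hP.pair p hp
  omega

end

/-! ### Words and symbols -/

section
variable {A : Type*} (ω : ℤ → A)

@[simp] theorem length_word (a b : ℤ) : (word ω a b).length = (b - a).toNat := by simp [word]

@[simp] theorem getElem_word (a b : ℤ) (t : ℕ) (h : t < (word ω a b).length) :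
    (word ω a b)[t] = ω (a + t) := by simp [word]

theorem word_append {a b c : ℤ} (hab : a ≤ b) (hbc : b ≤ c) :
    word ω a b ++ word ω b c = word ω a c := by
  apply List.ext_getElem
  · simp; omega
  · intro t h1 h2
    rw [List.getElem_append]
    split_ifs with h
    · simp
    · simp only [getElem_word, length_word] at h ⊢
      congr 1; omega

theorem mem_word {a b : ℤ} {p : A} : p ∈ word ω a b ↔ ∃ t : ℤ, a ≤ t ∧ t < b ∧ ω t = p := by
  simp only [word, List.mem_ofFn]
  constructor
  · rintro ⟨t, rfl⟩; exact ⟨a + t, by omega, by omega, rfl⟩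
  · rintro ⟨t, h1, h2, rfl⟩; exact ⟨⟨(t - a).toNat, by omega⟩, by congr 1; simp; omega⟩

theorem pairwise_word {R : A → A → Prop} {a b : ℤ} : (word ω a b).Pairwise R ↔
    ∀ s t : ℤ, a ≤ s → s < t → t < b → R (ω s) (ω t) := by
  rw [word, List.pairwise_ofFn]
  constructor
  · intro h s t h1 h2 h3
    have := @h ⟨(s - a).toNat, by omega⟩ ⟨(t - a).toNat, by omega⟩ (by simp; omega)
    simpa [show a + max (s - a) 0 = s by omega, show a + max (t - a) 0 = t by omega] using this
  · intro h i j hij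
    exact h _ _ (by omega) (by have : (i : ℕ) < j := hij; omega) (by omega)

end

variable {ξ : EdgeOrdering}

theorem EdgeLT.ne {u u' v : Vertex} (h : EdgeLT ξ u u' v) : u ≠ u' := by
  obtain ⟨x, y, -, ⟨-, rfl, rfl⟩ | ⟨-, rfl, rfl⟩⟩ := h <;> simp

theorem EdgeLT.asymm {u u' v : Vertex} (h : EdgeLT ξ u u' v) : ¬ EdgeLT ξ u' u v := by
  obtain ⟨x, y, rfl, ⟨h, rfl, rfl⟩ | ⟨h, rfl, rfl⟩⟩ := h <;>
    rintro ⟨a, b, hv, ⟨h', e, -⟩ | ⟨h', e, -⟩⟩ <;> simp_all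

theorem SymbolLT.asymm {k : ℕ} {p q : Symbol k} (h : SymbolLT ξ p q) : ¬ SymbolLT ξ q p := by
  rintro ⟨m, hm, hlt'⟩
  obtain ⟨n, hn, hlt⟩ := h
  rcases lt_trichotomy n m with h | rfl | h
  · exact hlt'.ne (hn m.castSucc (by simpa using h)).symm
  · rw [hm _ Fin.castSucc_lt_succ] at hlt'
    exact hlt.asymm hlt'
  · exact hlt.ne (hm n.castSucc (by simpa using h)).symm

theorem SymbolLT.irrefl {k : ℕ} (p : Symbol k) : ¬ SymbolLT ξ p p := fun h => h.asymm h

theorem IsBasicBlock.le {k : ℕ} {v : Vertex} {l : List (Symbol k)} (h : IsBasicBlock ξ k v l) :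
    k ≤ v.1 + v.2 := by
  induction h <;> simp_all <;> omega

theorem IsBasicBlock.of_level_eq {k : ℕ} {v : Vertex} {l : List (Symbol k)}
    (h : IsBasicBlock ξ k v l) (hv : v.1 + v.2 = k) :
    l.Pairwise (SymbolLT ξ) ∧ ∀ p : Symbol k, p ∈ l ↔ p.vert (Fin.last k) = v := by
  cases h with
  | base hv h1 h2 => exact ⟨h1, h2⟩
  | left h => have := h.le; simp at this hv; omega
  | right h => have := h.le; simp at this hv; omega
  | interior_zero _ h _ => have := h.le; simp at this hv; omega
  | interior_one _ h _ => have := h.le; simp at this hv; omega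

/-! ### Uniqueness of the consistent factoring scheme -/

namespace IsConsistent

variable {k : ℕ} {ω : ℤ → Symbol k} {F G : FactoringScheme}

theorem end_eq_vert (hF : IsConsistent ξ k ω F) {i t : ℤ} (h1 : F.cut 0 i ≤ t)
    (h2 : t < F.cut 0 (i + 1)) : (ω t).vert (Fin.last k) = F.vert 0 i :=
  (((hF.block 0 i).of_level_eq (hF.level 0 i)).2 _).1 ((mem_word ω).2 ⟨t, h1, h2, rfl⟩)

/-- A basic block of level `k` lists all initial paths to its vertex in increasing order, so it
begins exactly at the least of them. The right side involves only `ω`. -/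
theorem range_cut_zero (hF : IsConsistent ξ k ω F) : Set.range (F.cut 0) =
    {t | ∀ q : Symbol k, q.vert (Fin.last k) = (ω t).vert (Fin.last k) →
      ¬ SymbolLT ξ q (ω t)} := by
  ext t
  obtain ⟨i, hi, hlt⟩ := exists_le_lt_of_strictMono (hF.strictMono 0) t
  obtain ⟨hp, hmem⟩ := (hF.block 0 i).of_level_eq (hF.level 0 i)
  rw [pairwise_word] at hp
  constructor
  · rintro ⟨j, rfl⟩ q hq hlt'
    have hq' : q ∈ word ω (F.cut 0 j) (F.cut 0 (j + 1)) := by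
      rw [((hF.block 0 j).of_level_eq (hF.level 0 j)).2, hq]
      exact hF.end_eq_vert le_rfl (hF.strictMono 0 (by omega))
    obtain ⟨s, h1, h2, rfl⟩ := (mem_word ω).1 hq'
    rcases h1.eq_or_lt with rfl | h1
    · exact SymbolLT.irrefl _ hlt'
    · obtain ⟨hp, -⟩ := (hF.block 0 j).of_level_eq (hF.level 0 j)
      rw [pairwise_word] at hp
      exact (hp _ _ le_rfl h1 h2).asymm hlt'
  · intro h
    rcases hi.eq_or_lt with h' | h'
    · exact ⟨i, h'⟩
    · refine absurd (hp _ _ le_rfl h' hlt) (h _ ?_)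
      rw [hF.end_eq_vert hi hlt, hF.end_eq_vert le_rfl (hi.trans_lt hlt)]

theorem sub_strictMono (hF : IsConsistent ξ k ω F) (m : ℕ) : StrictMono (F.sub m) := by
  intro i j hij
  have := hF.strictMono (m + 1) hij
  rw [hF.cut_succ, hF.cut_succ] at this
  exact (hF.strictMono m).lt_iff_lt.1 this

/-- The vertex of a block of level `k + m + 1` in terms of the blocks of level `k + m` that
constitute it. -/
theorem sub_cases (hF : IsConsistent ξ k ω F) (m : ℕ) (i : ℤ) :
    (F.sub m (i + 1) = F.sub m i + 1 ∧
      ((∃ x, F.vert (m + 1) i = (x + 1, 0) ∧ F.vert m (F.sub m i) = (x, 0)) ∨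
       (∃ y, F.vert (m + 1) i = (0, y + 1) ∧ F.vert m (F.sub m i) = (0, y)))) ∨
    (F.sub m (i + 1) = F.sub m i + 2 ∧ ∃ x y, F.vert (m + 1) i = (x + 1, y + 1) ∧
      ((ξ (x + 1, y + 1) = 0 ∧ F.vert m (F.sub m i) = (x + 1, y) ∧
        F.vert m (F.sub m i + 1) = (x, y + 1)) ∨
       (ξ (x + 1, y + 1) = 1 ∧ F.vert m (F.sub m i) = (x, y + 1) ∧
        F.vert m (F.sub m i + 1) = (x + 1, y)))) := by
  have hl := hF.level (m + 1) i
  have h1 := hF.left m i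
  have h2 := hF.right m i
  have h3 := hF.interior m i
  rcases hv : F.vert (m + 1) i with ⟨_ | x, _ | y⟩
  · simp [hv] at hl
  · obtain ⟨h, h'⟩ := h2 y (by rw [hv])
    exact Or.inl ⟨h, Or.inr ⟨y, rfl, h'⟩⟩
  · obtain ⟨h, h'⟩ := h1 x (by rw [hv])
    exact Or.inl ⟨h, Or.inl ⟨x, rfl, h'⟩⟩
  · obtain ⟨h, h0, h1⟩ := h3 x y hv
    refine Or.inr ⟨h, x, y, rfl, ?_⟩
    rcases Fin.exists_fin_two.1 ⟨_, rfl⟩ with e | e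
    · exact Or.inl ⟨e, h0 e⟩
    · exact Or.inr ⟨e, h1 e⟩

theorem exists_isPairing (hF : IsConsistent ξ k ω F) (m : ℕ) :
    ∃ L, IsPairing (k + m) (fun l => ξ ((k + m + 1 - l).toNat, l.toNat) = 0)
      (fun p => (F.vert m p).2) (fun p => p + 1 ∉ Set.range (F.sub m)) L := by
  have hs := hF.sub_strictMono m
  choose fl hfl hfl' using exists_le_lt_of_strictMono hs
  have fl_eq : ∀ {p i : ℤ}, F.sub m i ≤ p → p < F.sub m (i + 1) → fl p = i := by
    intro p i h1 h2
    have a := hs.lt_iff_lt.1 ((hfl p).trans_lt h2)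
    have b := hs.lt_iff_lt.1 (h1.trans_lt (hfl' p))
    omega
  have width : ∀ i, F.sub m (i + 1) = F.sub m i + 1 ∨ F.sub m (i + 1) = F.sub m i + 2 :=
    fun i => (hF.sub_cases m i).imp And.left And.left
  have start : ∀ {p : ℤ}, p + 1 ∉ Set.range (F.sub m) →
      ∃ i, p = F.sub m i ∧ F.sub m (i + 1) = F.sub m i + 2 := by
    intro p hp
    have h1 := hfl p
    have h2 := hfl' p
    have h3 : F.sub m (fl p + 1) ≠ p + 1 := fun h => hp ⟨_, h⟩
    exact ⟨fl p, by have := width (fl p); omega, by have := width (fl p); omega⟩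
  have pair : ∀ i, F.sub m (i + 1) = F.sub m i + 2 →
      ∃ x y, F.vert (m + 1) i = (x + 1, y + 1) ∧
      ((ξ (x + 1, y + 1) = 0 ∧ F.vert m (F.sub m i) = (x + 1, y) ∧
        F.vert m (F.sub m i + 1) = (x, y + 1)) ∨
       (ξ (x + 1, y + 1) = 1 ∧ F.vert m (F.sub m i) = (x, y + 1) ∧
        F.vert m (F.sub m i + 1) = (x + 1, y))) := by
    intro i hi
    rcases hF.sub_cases m i with h | h
    · omega
    · exact h.2
  refine ⟨fun p => (F.vert (m + 1) (fl p)).2, ?_, ?_, ?_, ?_, ?_⟩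
  · intro p hp
    obtain ⟨i, rfl, hi⟩ := start hp
    exact not_not.2 ⟨i + 1, by omega⟩
  · intro p hp
    obtain ⟨i, rfl, hi⟩ := start hp
    rw [fl_eq le_rfl (by omega)]
    obtain ⟨x, y, hv, h⟩ := pair i hi
    have hl := hF.level (m + 1) i
    rw [hv] at hl ⊢
    have e : ((k : ℤ) + m + 1 - (y + 1 : ℕ)).toNat = x + 1 := by simp at hl ⊢; omega
    rcases h with ⟨h1, h2, h3⟩ | ⟨h1, h2, h3⟩ <;> simp only [h2, h3, e, Int.toNat_natCast] <;>
      simp [h1]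
  · intro p hp
    obtain ⟨i, rfl, hi⟩ := start hp
    rw [fl_eq le_rfl (by omega), fl_eq (p := F.sub m i + 1) (i := i) (by omega) (by omega)]
  · intro p hp hp'
    obtain ⟨j, hj⟩ := not_not.1 hp
    rw [sub_add_cancel] at hp'
    obtain ⟨i, rfl⟩ := not_not.1 hp'
    have hw := width i
    have h1 : F.sub m (i + 1) = F.sub m i + 1 := by
      by_contra hne
      have a := hs.lt_iff_lt.1 (show F.sub m i < F.sub m j by omega)
      have b := hs.lt_iff_lt.1 (show F.sub m j < F.sub m (i + 1) by omega)
      omega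
    rw [fl_eq le_rfl (by omega)]
    rcases hF.sub_cases m i with ⟨-, ⟨x, h, h'⟩ | ⟨y, h, h'⟩⟩ | h
    · simp [h, h']
    · have hl := hF.level m (F.sub m i)
      simp [h, h'] at hl ⊢
      omega
    · omega
  · intro p hp
    obtain ⟨i, rfl, hi⟩ := start hp
    have w1 := width (i + 1)
    have w2 := width (i - 1)
    have m2 := @hs (i + 1) (i + 1 + 1) (by omega)
    rw [sub_add_cancel] at w2
    rw [fl_eq le_rfl (by omega), fl_eq (p := F.sub m i + 2) (i := i + 1) (by omega) (by omega),
      fl_eq (p := F.sub m i - 1) (i := i - 1) (by omega) (by rw [sub_add_cancel]; omega)]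
    obtain ⟨x, y, hv, -⟩ := pair i hi
    -- The block of level `k + m + 2` containing block `i` cannot lie at a boundary vertex, since
    -- block `i` does not; hence it has a second constituent.
    obtain ⟨j, hj, hj'⟩ := exists_le_lt_of_strictMono (hF.sub_strictMono (m + 1)) i
    rcases hF.sub_cases (m + 1) j with ⟨hw, h⟩ | ⟨hw, a, b, -, h⟩
    · obtain rfl : i = F.sub (m + 1) j := by omega
      simp [hv] at h
    · rcases (show i = F.sub (m + 1) j ∨ i = F.sub (m + 1) j + 1 by omega) with rfl | rfl
      · rcases h with ⟨-, h1, h2⟩ | ⟨-, h1, h2⟩ <;> simp [h1, h2]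
      · rw [show F.sub (m + 1) j + 1 - 1 = F.sub (m + 1) j by ring]
        rcases h with ⟨-, h1, h2⟩ | ⟨-, h1, h2⟩ <;> simp [h1, h2]

theorem cut_vert_eq (hk : 3 ≤ k) (hF : IsConsistent ξ k ω F) (hG : IsConsistent ξ k ω G) (m : ℕ) :
    F.cut m = G.cut m ∧ F.vert m = G.vert m := by
  induction m with
  | zero =>
    have hc : F.cut 0 = G.cut 0 := strictMono_int_ext (hF.strictMono 0) (hG.strictMono 0)
      (hF.range_cut_zero.trans hG.range_cut_zero.symm) (hF.central 0) (hG.central 0)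
    refine ⟨hc, funext fun i => ?_⟩
    rw [← hF.end_eq_vert le_rfl (hF.strictMono 0 (lt_add_one i)),
      ← hG.end_eq_vert le_rfl (hG.strictMono 0 (lt_add_one i)), hc]
  | succ m ih =>
    obtain ⟨hc, hv⟩ := ih
    obtain ⟨L, hL⟩ := hF.exists_isPairing m
    obtain ⟨M, hM⟩ := hG.exists_isPairing m
    have hy : ∀ p : ℤ, 0 ≤ ((F.vert m p).2 : ℤ) ∧ ((F.vert m p).2 : ℤ) ≤ k + m := fun p => by
      have := hF.level m p
      omega
    rw [← hv] at hM
    have hr : Set.range (F.sub m) = Set.range (G.sub m) := by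
      ext p
      have h1 := hL.le (p := p - 1) (by omega) hy hM
      have h2 := hM.le (p := p - 1) (by omega) hy hL
      rw [sub_add_cancel] at h1 h2
      exact not_iff_not.1 ⟨h1, h2⟩
    have hcF : F.cut (m + 1) = F.cut m ∘ F.sub m := funext (hF.cut_succ m)
    have hcG : G.cut (m + 1) = G.cut m ∘ G.sub m := funext (hG.cut_succ m)
    have hc' : F.cut (m + 1) = G.cut (m + 1) :=
      strictMono_int_ext (hF.strictMono _) (hG.strictMono _)
        (by rw [hcF, hcG, Set.range_comp, Set.range_comp, hr, hc])
        (hF.central _) (hG.central _)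
    have hs : F.sub m = G.sub m := by
      rw [hcF, hcG, hc] at hc'
      exact (hG.strictMono m).injective.comp_left hc'
    refine ⟨hc', funext fun i => ?_⟩
    -- The constituents determine the vertex. The level excludes the root, the only vertex of both
    -- forms `(x, 0)` and `(0, z)`.
    have hl := hF.level m (F.sub m i)
    rcases hF.sub_cases m i with ⟨hw, h⟩ | ⟨hw, a, b, h, h'⟩ <;>
      rcases hG.sub_cases m i with ⟨hw', g⟩ | ⟨hw', c, d, g, g'⟩
    · rw [← hs, ← hv] at g
      rcases h with ⟨x, h, h'⟩ | ⟨x, h, h'⟩ <;> rcases g with ⟨z, g, g'⟩ | ⟨z, g, g'⟩ <;>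
        rw [h, g] <;> rw [h'] at g' hl <;> simp at g' hl ⊢ <;> omega
    · rw [hs] at hw; omega
    · rw [hs] at hw; omega
    · rw [← hs, ← hv] at g'
      rw [h, g]
      rcases h' with ⟨-, h1, h2⟩ | ⟨-, h1, h2⟩ <;> rcases g' with ⟨-, g1, g2⟩ | ⟨-, g1, g2⟩ <;>
        rw [h1] at g1 <;> rw [h2] at g2 <;> simp at g1 g2 ⊢ <;> omega

theorem unique (hk : 3 ≤ k) (hF : IsConsistent ξ k ω F) (hG : IsConsistent ξ k ω G) : F = G := by
  have h := hF.cut_vert_eq hk hG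
  have hs : F.sub = G.sub := by
    funext m i
    have e := congrFun (h (m + 1)).1 i
    rw [hF.cut_succ, hG.cut_succ, (h m).1] at e
    exact (hG.strictMono m).injective e
  have hc : F.cut = G.cut := funext fun m => (h m).1
  have hv : F.vert = G.vert := funext fun m => (h m).2
  cases F; cases G
  simp_all

end IsConsistent

/-! ### Heights and ranks -/

/-- The number of paths from the root to `v`. -/
def height (v : Vertex) : ℕ := (v.1 + v.2).choose v.1

theorem height_pos (v : Vertex) : 0 < height v := Nat.choose_pos (by omega)

theorem height_succ_succ (x y : ℕ) :
    height (x + 1, y + 1) = height (x + 1, y) + height (x, y + 1) := by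
  simp only [height]
  rw [show x + 1 + (y + 1) = x + 1 + y + 1 by ring, Nat.choose_succ_succ, add_comm,
    show x + (y + 1) = x + 1 + y by ring]

open Classical in
/-- The number of paths to `v` whose last edge is less than the edge from `u` to `v`. -/
noncomputable def offset (ξ : EdgeOrdering) (u v : Vertex) : ℕ :=
  if ∃ u', EdgeLT ξ u' u v then height v - height u else 0

/-- The number of initial paths of length `n` with the same end vertex as that of `p` that are
less than that of `p`. -/
noncomputable def rank (ξ : EdgeOrdering) (p : ℕ → Vertex) : ℕ → ℕ
  | 0 => 0
  | n + 1 => rank ξ p n + offset ξ (p n) (p (n + 1))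

theorem Edge.level {u v : Vertex} (h : Edge u v) : v.1 + v.2 = u.1 + u.2 + 1 := by
  rcases h with rfl | rfl <;> simp <;> omega

theorem EdgeLT.height_eq {u u' v : Vertex} (h : EdgeLT ξ u u' v) :
    height v = height u + height u' := by
  obtain ⟨x, y, rfl, ⟨-, rfl, rfl⟩ | ⟨-, rfl, rfl⟩⟩ := h
  · rw [height_succ_succ, add_comm]
  · rw [height_succ_succ]

theorem EdgeLT.offset_left {u u' v : Vertex} (h : EdgeLT ξ u u' v) : offset ξ u v = 0 := by
  rw [offset, if_neg]
  rintro ⟨w, hw⟩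
  obtain ⟨x, y, rfl, ⟨h, rfl, rfl⟩ | ⟨h, rfl, rfl⟩⟩ := h <;>
    obtain ⟨a, b, hv, ⟨h', -, e⟩ | ⟨h', -, e⟩⟩ := hw <;> simp_all

theorem EdgeLT.offset_right {u u' v : Vertex} (h : EdgeLT ξ u u' v) :
    offset ξ u' v = height u := by
  rw [offset, if_pos ⟨u, h⟩, h.height_eq]
  omega

theorem EdgeLT.edge_left {u u' v : Vertex} (h : EdgeLT ξ u u' v) : Edge u v := by
  obtain ⟨x, y, rfl, ⟨h, rfl, rfl⟩ | ⟨h, rfl, rfl⟩⟩ := h <;> simp [Edge]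

theorem EdgeLT.edge_right {u u' v : Vertex} (h : EdgeLT ξ u u' v) : Edge u' v := by
  obtain ⟨x, y, rfl, ⟨h, rfl, rfl⟩ | ⟨h, rfl, rfl⟩⟩ := h <;> simp [Edge]

theorem EdgeLT.eq_or_eq {u u' v w : Vertex} (h : EdgeLT ξ u u' v) (hw : Edge w v) :
    w = u ∨ w = u' := by
  obtain ⟨x, y, rfl, ⟨h, rfl, rfl⟩ | ⟨h, rfl, rfl⟩⟩ := h <;>
    rcases w with ⟨a, b⟩ <;> simp [Edge] at hw ⊢ <;> omega

theorem edgeLT_interior (ξ : EdgeOrdering) (x y : ℕ) :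
    (ξ (x + 1, y + 1) = 1 ∧ EdgeLT ξ (x, y + 1) (x + 1, y) (x + 1, y + 1)) ∨
    (ξ (x + 1, y + 1) = 0 ∧ EdgeLT ξ (x + 1, y) (x, y + 1) (x + 1, y + 1)) := by
  rcases Fin.exists_fin_two.1 ⟨ξ (x + 1, y + 1), rfl⟩ with e | e
  · exact Or.inr ⟨e, x, y, rfl, Or.inr ⟨e, rfl, rfl⟩⟩
  · exact Or.inl ⟨e, x, y, rfl, Or.inl ⟨e, rfl, rfl⟩⟩

theorem Edge.eq_or_edgeLT {u w v : Vertex} (hu : Edge u v) (hw : Edge w v) (ξ : EdgeOrdering) :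
    u = w ∨ EdgeLT ξ u w v ∨ EdgeLT ξ w u v := by
  rcases u with ⟨a, b⟩
  rcases w with ⟨c, d⟩
  rcases hu with rfl | rfl <;> rcases hw with hw | hw <;> simp only [Prod.mk.injEq] at hw
  · left; ext <;> simp <;> omega
  · obtain ⟨rfl, rfl⟩ := hw
    have := edgeLT_interior ξ a d
    tauto
  · obtain ⟨rfl, rfl⟩ := hw
    have := edgeLT_interior ξ c b
    tauto
  · left; ext <;> simp <;> omega

theorem Edge.boundary_or_edgeLT {u v : Vertex} (h : Edge u v) (ξ : EdgeOrdering) :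
    (offset ξ u v = 0 ∧ height v = height u) ∨ ∃ u', EdgeLT ξ u u' v ∨ EdgeLT ξ u' u v := by
  rcases v with ⟨_ | x, y⟩
  · left
    have hu : u.1 = 0 := by rcases h with h | h <;> simp at h; exact h.1.symm
    refine ⟨if_neg ?_, by simp [height, hu]⟩
    rintro ⟨w, a, b, hv, -⟩
    simp at hv
  · rcases y with _ | y
    · left
      have hu : u.2 = 0 := by rcases h with h | h <;> simp at h; exact h.2.symm
      refine ⟨if_neg ?_, by simp [height, hu]⟩
      rintro ⟨w, a, b, hv, -⟩
      simp at hv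
    · right
      rcases edgeLT_interior ξ x y with ⟨-, e⟩ | ⟨-, e⟩ <;> rcases e.eq_or_eq h with rfl | rfl
      exacts [⟨_, Or.inl e⟩, ⟨_, Or.inr e⟩, ⟨_, Or.inl e⟩, ⟨_, Or.inr e⟩]

theorem Edge.height_offset {u v : Vertex} (h : Edge u v) (ξ : EdgeOrdering) :
    height u + offset ξ u v ≤ height v := by
  rcases h.boundary_or_edgeLT ξ with ⟨h1, h2⟩ | ⟨w, h | h⟩
  · omega
  · rw [h.offset_left, h.height_eq]; omega
  · rw [h.offset_right, h.height_eq]; omega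

theorem rank_congr {p q : ℕ → Vertex} {n : ℕ} (h : ∀ i ≤ n, p i = q i) :
    rank ξ p n = rank ξ q n := by
  induction n with
  | zero => rfl
  | succ n ih => rw [rank, rank, ih fun i hi => h i (by omega), h n (by omega), h (n + 1) le_rfl]

theorem exists_rank_eq (ξ : EdgeOrdering) (n : ℕ) : ∀ (v : Vertex), v.1 + v.2 = n →
    ∀ t < height v, ∃ p : ℕ → Vertex, p 0 = (0, 0) ∧ (∀ i < n, Edge (p i) (p (i + 1))) ∧
      p n = v ∧ rank ξ p n = t := by
  induction n with
  | zero =>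
    rintro ⟨x, y⟩ hv t ht
    obtain ⟨rfl, rfl⟩ : x = 0 ∧ y = 0 := by simp at hv; omega
    refine ⟨fun _ => (0, 0), rfl, by simp, rfl, ?_⟩
    simp [height] at ht
    simp [rank, ht]
  | succ n ih =>
    intro v hv t ht
    have extend : ∀ u, Edge u v → ∀ s < height u, t = s + offset ξ u v →
        ∃ p : ℕ → Vertex, p 0 = (0, 0) ∧ (∀ i < n + 1, Edge (p i) (p (i + 1))) ∧
        p (n + 1) = v ∧ rank ξ p (n + 1) = t := by
      intro u hu s hs hts
      obtain ⟨p, h0, he, hp, hr⟩ := ih u (by have := hu.level; omega) s hs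
      refine ⟨fun i => if i ≤ n then p i else v, by simp [h0], fun i hi => ?_, by simp, ?_⟩
      · rcases (Nat.lt_succ_iff.1 hi).lt_or_eq with h | rfl
        · simp [h.le, Nat.succ_le_of_lt h, he i h]
        · simp [hp, hu]
      · rw [rank, rank_congr (q := p) (fun i hi => by simp [hi]), hr]
        simp [hp, hts]
    obtain ⟨u, hu⟩ : ∃ u, Edge u v := by
      rcases v with ⟨_ | x, y⟩
      · simp at hv; exact ⟨(0, n), Or.inr (by simp [hv])⟩
      · exact ⟨(x, y), Or.inl rfl⟩
    -- Ranks below `height a` are realised through the lesser edge, the remaining ones through the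
    -- greater edge.
    have split : ∀ a b, EdgeLT ξ a b v → ∃ p : ℕ → Vertex, p 0 = (0, 0) ∧
        (∀ i < n + 1, Edge (p i) (p (i + 1))) ∧ p (n + 1) = v ∧ rank ξ p (n + 1) = t := by
      intro a b h
      have hh := h.height_eq
      by_cases hlt : t < height a
      · exact extend a h.edge_left t hlt (by rw [h.offset_left, add_zero])
      · exact extend b h.edge_right (t - height a) (by omega) (by rw [h.offset_right]; omega)
    rcases hu.boundary_or_edgeLT ξ with ⟨h1, h2⟩ | ⟨w, h | h⟩
    · exact extend u hu t (by omega) (by omega)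
    · exact split _ _ h
    · exact split _ _ h

/-! ### The order of the path space in terms of ranks -/

theorem Path.ext_vert {γ η : Path} (h : ∀ n, γ.vert n = η.vert n) : γ = η := by
  have : γ.vert = η.vert := funext h
  cases γ; cases η
  simp_all

theorem Path.level (γ : Path) (n : ℕ) : (γ.vert n).1 + (γ.vert n).2 = n := by
  induction n with
  | zero => simp [γ.vert_zero]
  | succ n ih => rw [(γ.edge n).level, ih]

theorem rank_lt_height (γ : Path) (n : ℕ) : rank ξ γ.vert n < height (γ.vert n) := by
  induction n with
  | zero => exact height_pos _
  | succ n ih => have := (γ.edge n).height_offset ξ; rw [rank]; omega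

theorem EdgeLT.rank_lt {γ η : Path} {n : ℕ} (hv : γ.vert (n + 1) = η.vert (n + 1))
    (h : EdgeLT ξ (γ.vert n) (η.vert n) (γ.vert (n + 1))) :
    rank ξ γ.vert (n + 1) < rank ξ η.vert (n + 1) := by
  have := rank_lt_height (ξ := ξ) γ n
  rw [rank, rank, ← hv, h.offset_left, h.offset_right]
  omega

/-- If the last edges differ, every rank through the lesser edge is below every rank through the
greater one; so equal ranks force equal edges all the way down. -/
theorem vert_eq_of_rank_eq {γ η : Path} {n : ℕ} (hv : γ.vert n = η.vert n)
    (hr : rank ξ γ.vert n = rank ξ η.vert n) : ∀ i ≤ n, γ.vert i = η.vert i := by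
  induction n with
  | zero =>
    intro i hi
    obtain rfl : i = 0 := by omega
    exact hv
  | succ n ih =>
    rcases (γ.edge n).eq_or_edgeLT (hv ▸ η.edge n) ξ with h | h | h
    · intro i hi
      rcases hi.lt_or_eq with hi | rfl
      · refine ih h ?_ i (by omega)
        rw [rank, rank, hv, h] at hr
        omega
      · exact hv
    · have := h.rank_lt hv; omega
    · have := (hv ▸ h).rank_lt hv.symm; omega

/-- The paths `γ` and `η` coincide from level `n` on. -/
def SameTail (n : ℕ) (γ η : Path) : Prop := ∀ m, n ≤ m → γ.vert m = η.vert m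

theorem SameTail.symm {n : ℕ} {γ η : Path} (h : SameTail n γ η) : SameTail n η γ :=
  fun m hm => (h m hm).symm

theorem SameTail.trans {n : ℕ} {γ η δ : Path} (h : SameTail n γ η) (h' : SameTail n η δ) :
    SameTail n γ δ := fun m hm => (h m hm).trans (h' m hm)

theorem SameTail.mono {n m : ℕ} {γ η : Path} (h : SameTail n γ η) (hnm : n ≤ m) :
    SameTail m γ η := fun i hi => h i (hnm.trans hi)

/-- Beyond level `n` both ranks receive the same offsets, so their difference is constant. The
additive form avoids truncated subtraction. -/
theorem SameTail.rank_add {n m : ℕ} {γ η : Path} (h : SameTail n γ η) (hnm : n ≤ m) :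
    rank ξ γ.vert m + rank ξ η.vert n = rank ξ η.vert m + rank ξ γ.vert n := by
  induction m, hnm using Nat.le_induction with
  | base => omega
  | succ m hm ih => rw [rank, rank, h m hm, h (m + 1) (by omega)]; omega

theorem SameTail.eq {n : ℕ} {γ η : Path} (h : SameTail n γ η)
    (hr : rank ξ γ.vert n = rank ξ η.vert n) : γ = η := by
  refine Path.ext_vert fun i => ?_
  rcases le_total i n with hi | hi
  · exact vert_eq_of_rank_eq (h n le_rfl) hr i hi
  · exact h i hi

theorem SameTail.exists_rank_eq {n t : ℕ} (γ : Path) (ht : t < height (γ.vert n)) :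
    ∃ η, SameTail n γ η ∧ rank ξ η.vert n = t := by
  obtain ⟨p, h0, he, hp, hr⟩ := PascalAdic.exists_rank_eq ξ n (γ.vert n) (γ.level n) t ht
  refine ⟨⟨fun i => if i ≤ n then p i else γ.vert i, by simp [h0], fun i => ?_⟩, fun i hi => ?_, ?_⟩
  · rcases lt_trichotomy i n with h | rfl | h
    · simp [h.le, Nat.succ_le_of_lt h, he i h]
    · simp [hp, γ.edge]
    · simp [show ¬ i ≤ n by omega, show ¬ i + 1 ≤ n by omega, γ.edge]
  · rcases hi.eq_or_lt with rfl | h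
    · simp [hp]
    · simp [show ¬ i ≤ n by omega]
  · exact (rank_congr fun i hi => by simp [hi]).trans hr

theorem PathLT.exists_rank_lt {γ η : Path} (h : PathLT ξ γ η) :
    ∃ n, SameTail n γ η ∧ rank ξ γ.vert n < rank ξ η.vert n := by
  obtain ⟨n, hn, h⟩ := h
  exact ⟨n + 1, fun m hm => hn m (by omega), h.rank_lt (hn _ (by omega))⟩

theorem PathLT.rank_lt {n : ℕ} {γ η : Path} (h : PathLT ξ γ η) (ht : SameTail n γ η) :
    rank ξ γ.vert n < rank ξ η.vert n := by
  obtain ⟨m, hm, hr⟩ := h.exists_rank_lt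
  have h1 := hm.rank_add (ξ := ξ) (le_max_left m n)
  have h2 := ht.rank_add (ξ := ξ) (le_max_right m n)
  omega

/-- The last vertices at which two different paths with the same tail differ. -/
theorem SameTail.exists_edgeLT {n : ℕ} {γ η : Path} (h : SameTail n γ η)
    (hr : rank ξ γ.vert n < rank ξ η.vert n) :
    ∃ m < n, (∀ i, m < i → γ.vert i = η.vert i) ∧
      EdgeLT ξ (γ.vert m) (η.vert m) (γ.vert (m + 1)) := by
  induction n with
  | zero => simp [rank] at hr
  | succ n ih =>
    have hv := h (n + 1) le_rfl
    rcases (γ.edge n).eq_or_edgeLT (hv ▸ η.edge n) ξ with e | e | e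
    · obtain ⟨m, hm, hm'⟩ := ih (fun m hm => by
          rcases hm.eq_or_lt with rfl | hm
          · exact e
          · exact h m hm) (by rw [rank, rank, e, hv] at hr; omega)
      exact ⟨m, by omega, hm'⟩
    · exact ⟨n, by omega, fun i hi => h i hi, e⟩
    · have := (hv ▸ e).rank_lt hv.symm; omega

theorem SameTail.pathLT {n : ℕ} {γ η : Path} (h : SameTail n γ η)
    (hr : rank ξ γ.vert n < rank ξ η.vert n) : PathLT ξ γ η := by
  obtain ⟨m, -, hm⟩ := h.exists_edgeLT hr
  exact ⟨m, hm⟩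

theorem PathLT.asymm {γ η : Path} (h : PathLT ξ γ η) : ¬ PathLT ξ η γ := fun h' => by
  obtain ⟨n, hn, hr⟩ := h.exists_rank_lt
  have := h'.rank_lt hn.symm
  omega

/-! ### The adic transformation in terms of ranks -/

/-- Any competitor can be compared at a level where all three tails agree, and no integer lies
strictly between consecutive ranks. -/
theorem SameTail.adicStep {n : ℕ} {γ η : Path} (h : SameTail n γ η)
    (hr : rank ξ η.vert n = rank ξ γ.vert n + 1) : AdicStep ξ γ η := by
  have hlt := h.pathLT (ξ := ξ) (by omega)
  refine ⟨fun hmax => ?_, hlt, fun δ hδ => ?_⟩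
  · obtain ⟨m, -, hm⟩ := hlt
    exact hmax m ⟨_, hm⟩
  · obtain ⟨m, hm, hr'⟩ := hδ.exists_rank_lt
    have h1 := h.rank_add (ξ := ξ) (le_max_left n m)
    have h2 := hm.rank_add (ξ := ξ) (le_max_right n m)
    have ht := (h.symm.mono (le_max_left n m)).trans (hm.mono (le_max_right n m))
    rcases (show rank ξ η.vert (max n m) ≤ rank ξ δ.vert (max n m) by omega).eq_or_lt with e | e
    · exact Or.inl (ht.eq e)
    · exact Or.inr (ht.pathLT e)

theorem AdicStep.right_unique {γ η δ : Path} (h : AdicStep ξ γ η) (h' : AdicStep ξ γ δ) :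
    η = δ := by
  rcases h.2.2 δ h'.2.1 with e | e
  · exact e
  · rcases h'.2.2 η h.2.1 with e' | e'
    · exact e'.symm
    · exact absurd e' e.asymm

/-- If `γ < δ` had the common image `η`, minimality of `η` above `γ` would give `η ≤ δ`, against `δ
< η`. -/
theorem AdicStep.left_unique {γ η δ : Path} (h : AdicStep ξ γ η) (h' : AdicStep ξ δ η) :
    γ = δ := by
  have no : ∀ {γ δ : Path}, AdicStep ξ γ η → AdicStep ξ δ η → ¬ PathLT ξ γ δ := by
    intro γ δ h h' hlt
    rcases h.2.2 δ hlt with rfl | e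
    · exact h'.2.1.asymm h'.2.1
    · exact e.asymm h'.2.1
  obtain ⟨n, hn, -⟩ := h.2.1.exists_rank_lt
  obtain ⟨m, hm, -⟩ := h'.2.1.exists_rank_lt
  have ht := (hn.mono (le_max_left n m)).trans (hm.symm.mono (le_max_right n m))
  rcases lt_trichotomy (rank ξ γ.vert (max n m)) (rank ξ δ.vert (max n m)) with e | e | e
  · exact absurd (ht.pathLT e) (no h h')
  · exact ht.eq e
  · exact absurd (ht.symm.pathLT e) (no h' h)

theorem AdicStep.of_rank_succ_lt {γ η : Path} (h : AdicStep ξ γ η) {n : ℕ}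
    (hr : rank ξ γ.vert n + 1 < height (γ.vert n)) :
    SameTail n γ η ∧ rank ξ η.vert n = rank ξ γ.vert n + 1 := by
  obtain ⟨δ, ht, hδ⟩ := SameTail.exists_rank_eq (ξ := ξ) γ hr
  rw [h.right_unique (ht.adicStep hδ)]
  exact ⟨ht, hδ⟩

theorem AdicStep.of_rank_pos {γ η : Path} (h : AdicStep ξ γ η) {n : ℕ}
    (hr : 0 < rank ξ η.vert n) :
    SameTail n γ η ∧ rank ξ η.vert n = rank ξ γ.vert n + 1 := by
  have := rank_lt_height (ξ := ξ) η n
  obtain ⟨δ, ht, hδ⟩ := SameTail.exists_rank_eq (ξ := ξ) (t := rank ξ η.vert n - 1) η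
    (n := n) (by omega)
  rw [h.left_unique (ht.symm.adicStep (by omega))]
  exact ⟨ht.symm, by omega⟩

theorem AdicStep.rank_eq_zero {γ η : Path} (h : AdicStep ξ γ η) {n : ℕ}
    (hr : rank ξ γ.vert n + 1 = height (γ.vert n)) : rank ξ η.vert n = 0 := by
  by_contra h0
  obtain ⟨ht, hr'⟩ := h.of_rank_pos (Nat.pos_of_ne_zero h0)
  have := rank_lt_height (ξ := ξ) η n
  rw [← ht n le_rfl] at this
  omega

theorem exists_adicStep {γ : Path} (h : γ ∉ maxPaths ξ) : ∃ η, AdicStep ξ γ η := by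
  simp only [maxPaths, Set.mem_ofPred_eq, not_forall, not_not] at h
  obtain ⟨n, u, hu⟩ := h
  have h1 := rank_lt_height (ξ := ξ) γ n
  have h2 := height_pos u
  obtain ⟨η, ht, hη⟩ := SameTail.exists_rank_eq (ξ := ξ) (t := rank ξ γ.vert (n + 1) + 1) γ
    (n := n + 1) (by rw [rank, hu.offset_left, hu.height_eq]; omega)
  exact ⟨η, ht.adicStep hη⟩

theorem exists_adicStep_to {γ : Path} (h : γ ∉ minPaths ξ) : ∃ η, AdicStep ξ η γ := by
  simp only [minPaths, Set.mem_ofPred_eq, not_forall, not_not] at h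
  obtain ⟨n, u, hu⟩ := h
  have h1 := rank_lt_height (ξ := ξ) γ (n + 1)
  have h2 := height_pos u
  have h3 : height u ≤ rank ξ γ.vert (n + 1) := by rw [rank, hu.offset_right]; omega
  obtain ⟨η, ht, hη⟩ := SameTail.exists_rank_eq (ξ := ξ) (t := rank ξ γ.vert (n + 1) - 1) γ
    (n := n + 1) (by omega)
  exact ⟨η, ht.symm.adicStep (by omega)⟩

/-! ### Orbits -/

theorem AdicIterNat.right_unique {n : ℕ} {γ η δ : Path} (h : AdicIterNat ξ n γ η)
    (h' : AdicIterNat ξ n γ δ) : η = δ := by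
  induction n generalizing η δ with
  | zero => exact h.symm.trans h'
  | succ n ih =>
    obtain ⟨a, ha, ha'⟩ := h
    obtain ⟨b, hb, hb'⟩ := h'
    obtain rfl := ih ha hb
    exact ha'.right_unique hb'

theorem AdicIterNat.left_unique {n : ℕ} {γ η δ : Path} (h : AdicIterNat ξ n γ η)
    (h' : AdicIterNat ξ n δ η) : γ = δ := by
  induction n generalizing η with
  | zero => exact Eq.trans h (Eq.symm h')
  | succ n ih =>
    obtain ⟨a, ha, ha'⟩ := h
    obtain ⟨b, hb, hb'⟩ := h'
    obtain rfl := ha'.left_unique hb'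
    exact ih ha hb

theorem adicIterNat_succ' {n : ℕ} {γ η : Path} :
    AdicIterNat ξ (n + 1) γ η ↔ ∃ δ, AdicStep ξ γ δ ∧ AdicIterNat ξ n δ η := by
  induction n generalizing η with
  | zero => simp [AdicIterNat]
  | succ n ih =>
    rw [AdicIterNat]
    simp only [ih]
    rw [show (∃ δ, AdicStep ξ γ δ ∧ AdicIterNat ξ (n + 1) δ η) ↔
      ∃ δ, AdicStep ξ γ δ ∧ ∃ ε, AdicIterNat ξ n δ ε ∧ AdicStep ξ ε η from Iff.rfl]
    tauto

theorem AdicIter.unique {n : ℤ} {γ η δ : Path} (h : AdicIter ξ n γ η)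
    (h' : AdicIter ξ n γ δ) : η = δ := by
  cases n with
  | ofNat n => exact AdicIterNat.right_unique h h'
  | negSucc n => exact AdicIterNat.left_unique h h'

theorem exists_adicIterNat {γ : Path} (hγ : γ ∉ exceptionalPaths ξ) (n : ℕ) :
    ∃ η, AdicIterNat ξ n γ η := by
  induction n with
  | zero => exact ⟨γ, rfl⟩
  | succ n ih =>
    obtain ⟨η, h⟩ := ih
    -- A maximal path on the forward orbit would make `γ` one of its backward iterates. The case of
    -- zero is separate because `Int.negSucc` starts at `-1`.
    have hη : η ∉ maxPaths ξ := fun hmax => hγ ⟨η, Or.inr hmax, by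
      cases n with
      | zero => exact ⟨0, Eq.symm h⟩
      | succ n => exact ⟨Int.negSucc n, h⟩⟩
    obtain ⟨δ, hδ⟩ := exists_adicStep hη
    exact ⟨δ, η, h, hδ⟩

theorem exists_adicIterNat_to {γ : Path} (hγ : γ ∉ exceptionalPaths ξ) (n : ℕ) :
    ∃ η, AdicIterNat ξ n η γ := by
  induction n with
  | zero => exact ⟨γ, rfl⟩
  | succ n ih =>
    obtain ⟨η, h⟩ := ih
    have hη : η ∉ minPaths ξ := fun hmin => hγ ⟨η, Or.inl hmin, n, h⟩
    obtain ⟨δ, hδ⟩ := exists_adicStep_to hη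
    exact ⟨δ, adicIterNat_succ'.2 ⟨η, hδ, h⟩⟩

theorem exists_orbit {γ : Path} (hγ : γ ∉ exceptionalPaths ξ) :
    ∃ o : ℤ → Path, (∀ j, AdicIter ξ j γ (o j)) ∧ ∀ j, AdicStep ξ (o j) (o (j + 1)) := by
  have ex : ∀ j : ℤ, ∃ η, AdicIter ξ j γ η := by
    rintro (n | n)
    · exact exists_adicIterNat hγ n
    · exact exists_adicIterNat_to hγ (n + 1)
  choose o ho using ex
  refine ⟨o, ho, ?_⟩
  rintro (n | n)
  · obtain ⟨δ, h, hs⟩ : AdicIterNat ξ (n + 1) γ (o (Int.ofNat n + 1)) := ho (n + 1 : ℕ)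
    rwa [AdicIterNat.right_unique h (ho (n : ℕ))] at hs
  · obtain ⟨δ, hs, h⟩ := adicIterNat_succ'.1 (ho (Int.negSucc n))
    have e : δ = o (Int.negSucc n + 1) := by
      cases n with
      | zero => exact Eq.trans h (ho 0)
      | succ n => exact AdicIterNat.left_unique h (ho (Int.negSucc n))
    rwa [← e]

/-! ### Existence of the consistent factoring scheme -/

theorem Edge.source_left {u : Vertex} {x : ℕ} (h : Edge u (x + 1, 0)) : u = (x, 0) := by
  rcases u with ⟨a, b⟩
  simp [Edge] at h ⊢; omega

theorem Edge.source_right {u : Vertex} {y : ℕ} (h : Edge u (0, y + 1)) : u = (0, y) := by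
  rcases u with ⟨a, b⟩
  simp [Edge] at h ⊢; omega

theorem boundary_block {γ : Path} {n : ℕ} (h : rank ξ γ.vert (n + 1) = 0)
    (hv : ∀ x y, γ.vert (n + 1) ≠ (x + 1, y + 1)) :
    rank ξ γ.vert n = 0 ∧ height (γ.vert (n + 1)) = height (γ.vert n) := by
  rw [rank] at h
  refine ⟨by omega, ?_⟩
  rcases (γ.edge n).boundary_or_edgeLT ξ with ⟨-, h⟩ | ⟨w, ⟨a, b, e, -⟩ | ⟨a, b, e, -⟩⟩
  · exact h
  · exact absurd e (hv a b)
  · exact absurd e (hv a b)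

theorem rank_add_natCast {o : ℤ → Path} (ho : ∀ j, AdicStep ξ (o j) (o (j + 1)))
    {n : ℕ} {j : ℤ} {s : ℕ}
    (h : rank ξ (o j).vert n + s < height ((o j).vert n)) :
    SameTail n (o j) (o (j + s)) ∧ rank ξ (o (j + s)).vert n = rank ξ (o j).vert n + s := by
  induction s with
  | zero => simp [SameTail]
  | succ s ih =>
    obtain ⟨h1, h2⟩ := ih (by omega)
    obtain ⟨h3, h4⟩ := (ho (j + s)).of_rank_succ_lt (n := n)
      (by rw [← h1 n le_rfl, h2]; omega)
    push_cast
    rw [← add_assoc]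
    exact ⟨h1.trans h3, by omega⟩

theorem rank_add_height {o : ℤ → Path} (ho : ∀ j, AdicStep ξ (o j) (o (j + 1)))
    {n : ℕ} {j : ℤ} (h : rank ξ (o j).vert n = 0) :
    rank ξ (o (j + height ((o j).vert n))).vert n = 0 := by
  have hpos := height_pos ((o j).vert n)
  obtain ⟨h1, h2⟩ := rank_add_natCast ho (n := n) (j := j) (s := height ((o j).vert n) - 1)
    (by omega)
  have h3 := (ho (j + (height ((o j).vert n) - 1 : ℕ))).rank_eq_zero (n := n)
    (by rw [h2, ← h1 n le_rfl]; omega)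
  rwa [show j + (height ((o j).vert n) - 1 : ℕ) + 1 = j + height ((o j).vert n) by omega] at h3

theorem rank_sub_rank {o : ℤ → Path} (ho : ∀ j, AdicStep ξ (o j) (o (j + 1)))
    (n t : ℕ) (j : ℤ) (h : rank ξ (o j).vert n = t) :
    SameTail n (o (j - t)) (o j) ∧ rank ξ (o (j - t)).vert n = 0 := by
  induction t generalizing j with
  | zero => simpa [SameTail] using h
  | succ t ih =>
    have hs := ho (j - 1)
    rw [sub_add_cancel] at hs
    obtain ⟨h1, h2⟩ := hs.of_rank_pos (n := n) (by omega)
    obtain ⟨h3, h4⟩ := ih (j - 1) (by omega)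
    rw [show j - 1 - (t : ℤ) = j - (t + 1 : ℕ) by push_cast; ring] at h3 h4
    exact ⟨h3.trans h1, h4⟩

theorem exists_cut {o : ℤ → Path} (ho : ∀ j, AdicStep ξ (o j) (o (j + 1)))
    (n : ℕ) : ∃ f : ℤ → ℤ, StrictMono f ∧
    Set.range f = {j | rank ξ (o j).vert n = 0} ∧ (f 0 ≤ 0 ∧ 0 < f 1) ∧
    ∀ i, f (i + 1) = f i + height ((o (f i)).vert n) := by
  obtain ⟨f, hf, hr, h0⟩ := exists_enumeration (S := {j | rank ξ (o j).vert n = 0})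
    (fun z => ⟨_, (rank_sub_rank ho n _ z rfl).2, by omega⟩)
    (fun z => by
      obtain ⟨h1, h2⟩ := rank_sub_rank ho n _ z rfl
      refine ⟨_, rank_add_height ho h2, ?_⟩
      have := rank_lt_height (ξ := ξ) (o z) n
      rw [h1 n le_rfl]
      omega)
  have hz : ∀ i, rank ξ (o (f i)).vert n = 0 := fun i => by
    have : f i ∈ Set.range f := ⟨i, rfl⟩
    rwa [hr] at this
  refine ⟨f, hf, hr, h0, fun i => ?_⟩
  obtain ⟨a, ha⟩ : f i + height ((o (f i)).vert n) ∈ Set.range f := by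
    rw [hr]; exact rank_add_height ho (hz i)
  have hpos := height_pos ((o (f i)).vert n)
  have hlt := hf.lt_iff_lt.1 (show f i < f a by omega)
  have h1 := hf.monotone (show i + 1 ≤ a by omega)
  have h2 := hf (lt_add_one i)
  -- An earlier cut would fall inside the block, where the rank equals the positive time elapsed
  -- since `f i`.
  by_contra hne
  have h3 := (rank_add_natCast ho (n := n) (j := f i) (s := (f (i + 1) - f i).toNat)
    (by rw [hz]; omega)).2
  rw [show f i + ((f (i + 1) - f i).toNat : ℤ) = f (i + 1) by omega, hz, hz] at h3
  omega

/-- The blocks of level `n` inside a block of level `n + 1`. -/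
theorem split_block {o : ℤ → Path} (ho : ∀ j, AdicStep ξ (o j) (o (j + 1)))
    {n : ℕ} {j : ℤ} (h : rank ξ (o j).vert (n + 1) = 0) {x y : ℕ}
    (hv : (o j).vert (n + 1) = (x + 1, y + 1)) :
    ∃ u u', EdgeLT ξ u u' (x + 1, y + 1) ∧ rank ξ (o j).vert n = 0 ∧ (o j).vert n = u ∧
      rank ξ (o (j + height u)).vert n = 0 ∧ (o (j + height u)).vert n = u' := by
  have he := (o j).edge n
  rw [hv] at he
  rw [rank, hv] at h
  obtain ⟨u', hu⟩ : ∃ u', EdgeLT ξ ((o j).vert n) u' (x + 1, y + 1) := by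
    rcases edgeLT_interior ξ x y with ⟨-, e⟩ | ⟨-, e⟩ <;> rcases e.eq_or_eq he with h' | h'
    · exact ⟨_, h' ▸ e⟩
    · rw [h', e.offset_right] at h
      have := height_pos (x, y + 1); omega
    · exact ⟨_, h' ▸ e⟩
    · rw [h', e.offset_right] at h
      have := height_pos (x + 1, y); omega
  have h0 : rank ξ (o j).vert n = 0 := by omega
  obtain ⟨h1, h2⟩ := rank_add_natCast ho (n := n + 1) (j := j) (s := height ((o j).vert n)) (by
    have := height_pos u'
    rw [rank, hv, h, hu.height_eq]; omega)
  rw [rank, rank, ← h1 (n + 1) le_rfl, hv, h] at h2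
  have he' := (o (j + height ((o j).vert n))).edge n
  rw [← h1 (n + 1) le_rfl, hv] at he'
  have hlt := rank_lt_height (ξ := ξ) (o (j + height ((o j).vert n))) n
  refine ⟨_, u', hu, h0, rfl, rank_add_height ho h0, ?_⟩
  -- After `height u` steps the rank at level `n + 1` is `height u`. Arriving through the lesser
  -- edge would require this same rank at level `n`, which is out of range.
  rcases hu.eq_or_eq he' with e | e
  · rw [e, hu.offset_left] at h2
    rw [e] at hlt
    omega
  · exact e

/-- Starting at rank zero, the next `height` steps run through all initial paths to the vertex in
increasing order; at higher levels `split_block` reproduces the recursion of the basic blocks. -/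
theorem isBasicBlock_word {o : ℤ → Path} (ho : ∀ j, AdicStep ξ (o j) (o (j + 1)))
    {k : ℕ} {ω : ℤ → Symbol k}
    (hω : ∀ j, o j ∈ cylinder (ω j)) {n : ℕ} (hn : k ≤ n) {j : ℤ}
    (h : rank ξ (o j).vert n = 0) :
    IsBasicBlock ξ k ((o j).vert n) (word ω j (j + height ((o j).vert n))) := by
  induction n, hn using Nat.le_induction generalizing j with
  | base =>
    have tail : ∀ s : ℤ, j ≤ s → s < j + height ((o j).vert k) →
        SameTail k (o j) (o s) ∧ (rank ξ (o s).vert k : ℤ) = s - j := by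
      intro s h1 h2
      have := rank_add_natCast ho (n := k) (j := j) (s := (s - j).toNat) (by omega)
      rw [show j + ((s - j).toNat : ℤ) = s by omega] at this
      exact ⟨this.1, by omega⟩
    refine .base ((o j).level k) ?_ ?_
    · rw [pairwise_word]
      intro s t h1 h2 h3
      obtain ⟨hs, hs'⟩ := tail s h1 (by omega)
      obtain ⟨ht, ht'⟩ := tail t (by omega) h3
      obtain ⟨m, hm, hm1, hm2⟩ := (hs.symm.trans ht).exists_edgeLT (ξ := ξ) (by omega)
      refine ⟨⟨m, hm⟩, fun i hi => ?_, ?_⟩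
      · rw [← hω s i, ← hω t i]
        exact hm1 _ hi
      · rw [← hω s, ← hω t, ← hω s]
        exact hm2
    · intro p
      rw [mem_word]
      constructor
      · rintro ⟨t, h1, h2, rfl⟩
        rw [← hω t]
        exact ((tail t h1 h2).1 k le_rfl).symm
      · intro hp
        -- Grafting `p` onto the tail of `o j` gives a path of the same tail class; its rank is the
        -- time at which the orbit visits it.
        let δ : Path := ⟨fun i => if hi : i < k + 1 then p.vert ⟨i, hi⟩ else (o j).vert i,
          by simpa using p.vert_zero, fun i => by
            rcases lt_trichotomy i k with hi | rfl | hi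
            · simpa [hi, hi.le, Nat.lt_succ_of_lt hi] using p.edge ⟨i, hi⟩
            · have := (o j).edge i
              rw [← hp] at this
              simpa [Fin.last] using this
            · simpa [show ¬ i < k + 1 by omega, show ¬ i < k by omega] using (o j).edge i⟩
        have hδ : SameTail k (o j) δ := fun i hi => by
          rcases hi.eq_or_lt with rfl | hi
          · simpa [δ, Fin.last] using hp.symm
          · simp [δ, show ¬ i < k + 1 by omega]
        have hr := rank_lt_height (ξ := ξ) δ k
        rw [← hδ k le_rfl] at hr
        have ht := tail (j + rank ξ δ.vert k) (by omega) (by omega)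
        have e := (ht.1.symm.trans hδ).eq (ξ := ξ) (by omega)
        refine ⟨j + rank ξ δ.vert k, by omega, by omega, ?_⟩
        have hc := hω (j + rank ξ δ.vert k)
        rw [e] at hc
        have : (ω (j + rank ξ δ.vert k)).vert = p.vert := funext fun i => by
          rw [← hc i]; simp [δ, show ¬ k < (i : ℕ) by omega]
        generalize ω (j + rank ξ δ.vert k) = q at this
        cases q; cases p
        simpa using this
  | succ n hn ih =>
    rcases hv : (o j).vert (n + 1) with ⟨x, y⟩
    have hl := (o j).level (n + 1)
    have he := (o j).edge n
    rw [hv] at hl he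
    rcases x with _ | x
    · obtain ⟨h0, hh⟩ := boundary_block h (by simp [hv])
      rcases y with _ | y
      · simp at hl
      have hu := he.source_right
      rw [← hv, hh, hv]
      have := ih h0
      rw [hu] at this ⊢
      exact this.right
    · rcases y with _ | y
      · obtain ⟨h0, hh⟩ := boundary_block h (by simp [hv])
        have hu := he.source_left
        rw [← hv, hh, hv]
        have := ih h0
        rw [hu] at this ⊢
        exact this.left
      · obtain ⟨u, u', hu, h0, h1, h2, h3⟩ := split_block ho h hv
        have b1 := ih h0
        have b2 := ih h2
        rw [h1] at b1
        rw [h3] at b2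
        rw [hu.height_eq, Nat.cast_add, ← add_assoc, ← word_append ω (b := j + height u)
          (by omega) (by omega)]
        obtain ⟨a, b, e, ⟨e', rfl, rfl⟩ | ⟨e', rfl, rfl⟩⟩ := hu <;>
          obtain ⟨rfl, rfl⟩ : x = a ∧ y = b := by simpa using e
        · exact .interior_one e' b1 b2
        · exact .interior_zero e' b1 b2

theorem exists_isConsistent {o : ℤ → Path} (ho : ∀ j, AdicStep ξ (o j) (o (j + 1)))
    {k : ℕ} {ω : ℤ → Symbol k} (hω : ∀ j, o j ∈ cylinder (ω j)) :
    ∃ F, IsConsistent ξ k ω F := by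
  choose f hf hr h0 hh using fun m : ℕ => exists_cut ho (k + m)
  have hz : ∀ m i, rank ξ (o (f m i)).vert (k + m) = 0 := fun m i => by
    have : f m i ∈ Set.range (f m) := ⟨i, rfl⟩
    rwa [hr] at this
  have mem : ∀ {m j}, rank ξ (o j).vert (k + m) = 0 → ∃ a, f m a = j := by
    intro m j h
    have : j ∈ Set.range (f m) := by rw [hr]; exact h
    exact this
  -- Offsets are nonnegative, so rank zero at one level forces rank zero at the level below: the
  -- cuts are nested.
  have hsub : ∀ m i, ∃ a, f m a = f (m + 1) i := by
    intro m i
    have := hz (m + 1) i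
    rw [← add_assoc, rank] at this
    exact mem (by omega)
  choose s hs using hsub
  have boundary : ∀ m i, (∀ x y, (o (f (m + 1) i)).vert (k + (m + 1)) ≠ (x + 1, y + 1)) →
      s m (i + 1) = s m i + 1 := by
    intro m i hv
    apply (hf m).injective
    rw [hs, hh, hh, hs, ← add_assoc, (boundary_block (n := k + m) (hz (m + 1) i) hv).2]
  refine ⟨⟨f, fun m i => (o (f m i)).vert (k + m), s⟩, hf, h0, fun m i => (o _).level _,
    fun m i => ?_, fun m i => (hs m i).symm, fun m i x hv => ?_, fun m i y hv => ?_,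
    fun m i x y hv => ?_⟩
  · simp only [hh]
    exact isBasicBlock_word ho hω (by omega) (hz m i)
  · simp only [hs] at hv ⊢
    refine ⟨boundary m i (by simp [hv]), ?_⟩
    have he := (o (f (m + 1) i)).edge (k + m)
    rw [add_assoc, hv] at he
    exact he.source_left
  · simp only [hs] at hv ⊢
    refine ⟨boundary m i (by simp [hv]), ?_⟩
    have he := (o (f (m + 1) i)).edge (k + m)
    rw [add_assoc, hv] at he
    exact he.source_right
  · simp only at hv ⊢
    obtain ⟨u, u', hu, g0, g1, g2, g3⟩ := split_block ho (n := k + m) (hz (m + 1) i) hv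
    have e1 : f m (s m i + 1) = f (m + 1) i + height u := by rw [hh, hs, g1]
    have e2 : s m (i + 1) = s m i + 2 := by
      apply (hf m).injective
      rw [hs, hh, hv, hu.height_eq, show s m i + 2 = s m i + 1 + 1 by ring, hh, e1, g3]
      push_cast; ring
    rw [e1, hs, g1, g3]
    refine ⟨e2, ?_⟩
    obtain ⟨a, b, e, ⟨e', rfl, rfl⟩ | ⟨e', rfl, rfl⟩⟩ := hu <;>
      obtain ⟨rfl, rfl⟩ : x = a ∧ y = b := by simpa using e
    · simp [e']
    · simp [e']

theorem cylinder_unique {k : ℕ} {γ : Path} {p q : Symbol k} (hp : γ ∈ cylinder p)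
    (hq : γ ∈ cylinder q) : p = q := by
  have : p.vert = q.vert := funext fun i => (hp i).symm.trans (hq i)
  cases p; cases q
  simp_all

end PascalAdic

theorem corollary3p5 (ξ : PascalAdic.EdgeOrdering) (γ : PascalAdic.Path)
    (hγ : γ ∉ PascalAdic.exceptionalPaths ξ) :
    (∃! ω : ℤ → PascalAdic.Symbol 3, PascalAdic.IsCoding ξ 3 γ ω) ∧
    ∀ ω : ℤ → PascalAdic.Symbol 3, PascalAdic.IsCoding ξ 3 γ ω →
      ∃! F : PascalAdic.FactoringScheme, PascalAdic.IsConsistent ξ 3 ω F := by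
  obtain ⟨o, ho, hs⟩ := PascalAdic.exists_orbit hγ
  have mem : ∀ {ω : ℤ → PascalAdic.Symbol 3}, PascalAdic.IsCoding ξ 3 γ ω →
      ∀ j, o j ∈ PascalAdic.cylinder (ω j) := by
    intro ω hω j
    obtain ⟨η, h1, h2⟩ := hω j
    rwa [(ho j).unique h1]
  refine ⟨⟨fun j => ⟨fun i => (o j).vert i, (o j).vert_zero, fun i => (o j).edge i⟩,
    fun j => ⟨o j, ho j, fun i => rfl⟩, fun ω hω => funext fun j =>
      PascalAdic.cylinder_unique (mem hω j) fun i => rfl⟩, fun ω hω => ?_⟩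
  obtain ⟨F, hF⟩ := PascalAdic.exists_isConsistent hs (mem hω)
  exact ⟨F, hF, fun G hG => hG.unique le_rfl hF⟩
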